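/- Symbolic algorithms. All directed graphs $G=(V,E)$ are finite, with $V=\{0,\dots,n-1\}$; self-loops are allowed. For $S\subseteq V$ let $\mathrm{Pre}(S)=\{v\in V : \exists s\in S,\ (v,s)\in E\}$ and $\mathrm{Post}(S)=\{v\in V : \exists s\in S,\ (s,v)\in E\}$. A symbolic algorithm may perform arbitrary computations and arbitrary basic set operations ($\cup,\cap,\setminus,\subseteq,=$) on arbitrarily many stored vertex sets, free of charge, and it knows $V$, but it can access the edges of $G$ only through one-step operations, each of which takes a vertex set $S$ and returns $\mathrm{Pre}(S)$ or $\mathrm{Post}(S)$. A randomized algorithm may in addition toss independent fair coins; a deterministic one tosses none. Reachability is the following problem: given explicitly $V$, a start vertex $s\in V$ and a target set $T\subseteq V$, and given the edges of $G$ through one-step operations only, decide whether some infinite path of $G$ starting in $s$ visits a vertex of $T$ at least once. The diameter of $G$ is the largest finite distance in $G$, i.e. the maximum of $\mathrm{dist}(u,v)$ over all pairs $u,v\in V$ such that $u$ can reach $v$. Theorem. Any deterministic or bounded-error randomized symbolic algorithm that solves Reachability on graphs with diameter $D$ requires $\Omega(D)$ one-step operations. Precisely: (1) There is a constant $c>0$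 such that for every integer $D\ge 0$ and every deterministic symbolic algorithm that halts with the correct answer on all instances of Reachability whose graph has diameter $D$, there is an instance whose graph has diameter $D$ on which the algorithm performs at least $cD$ one-step operations. (2) For every $\varepsilon$ with $0\le\varepsilon<1/2$ there is a constant $c>0$ such that for every integer $D\ge 0$ and every randomized symbolic algorithm that, on each instance of Reachability whose graph has diameter $D$, halts with the correct answer with probability at least $1-\varepsilon$, there is an instance whose graph has diameter $D$ on which the expected number of one-step operations of the algorithm (and hence also the worst-case number over its coin tosses) is at least $cD$. -/

import Mathlib

open MeasureTheory
open scoped ENNReal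

namespace Symbolic

/-! ### Directed graphs -/

section Graph

variable {V : Type}

/-- The predecessors of a vertex set: all vertices with an edge to some vertex of `S`. -/
def pre (G : Digraph V) (S : Set V) : Set V := {v | ∃ s ∈ S, G.Adj v s}

/-- The successors of a vertex set: all vertices with an edge from some vertex of `S`. -/
def post (G : Digraph V) (S : Set V) : Set V := {v | ∃ s ∈ S, G.Adj s v}

/-- There is a walk with exactly `k` edges from `u` to `v`. -/
def HasWalk (G : Digraph V) : ℕ → V → V → Prop
  | 0, u, v => u = v
  | k + 1, u, v => ∃ w, G.Adj u w ∧ HasWalk G k w v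

/-- `u` can reach `v` in `G`. -/
def CanReach (G : Digraph V) (u v : V) : Prop := ∃ k, HasWalk G k u v

/-- The smallest number of edges of a walk from `u` to `v`
(only used for vertices such that `u` can reach `v`). -/
noncomputable def dist (G : Digraph V) (u v : V) : ℕ := sInf {k | HasWalk G k u v}

/-- `D` is the diameter of `G`, the largest finite distance: the maximum of `dist u v` over all
pairs `u, v` such that `u` can reach `v`. -/
def HasDiameter (G : Digraph V) (D : ℕ) : Prop :=
  IsGreatest {d | ∃ u v, CanReach G u v ∧ dist G u v = d} D

/-- The reachability objective: some infinite path of `G` that starts in `s` visits a vertex of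
the target set `T` at least once. -/
def ReachObjective (G : Digraph V) (s : V) (T : Set V) : Prop :=
  ∃ p : ℕ → V, p 0 = s ∧ (∀ i, G.Adj (p i) (p (i + 1))) ∧ ∃ i, p i ∈ T

end Graph

/-! ### Symbolic algorithms -/

/-- What an algorithm working on a graph with the (known) vertex set `V` does in a given memory
configuration; `State` is the type of its memory configurations.

* `halt b`: stop with the answer `b`;
* `compute q`: any step that does not use the edges of the graph: the operations of an ordinary
  RAM and the basic set operations (union, intersection, difference, inclusion and equality
  tests) on vertex sets stored in memory; the next configuration is `q`;
* `flip k`: toss a fair coin and continue in the configuration `k b` for the outcome `b`;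
* `pre S k`, `post S k`: the one-step operations; the vertex set `Pre(S)` or `Post(S)` is
  returned, and the algorithm continues in the configuration that `k` assigns to this set. -/
inductive Instr (V State : Type) : Type
  | halt (b : Bool)
  | compute (q : State)
  | flip (k : Bool → State)
  | pre (S : Set V) (k : Set V → State)
  | post (S : Set V) (k : Set V → State)

/-- The instruction is a one-step operation. -/
def Instr.IsOneStep {V State : Type} : Instr V State → Prop
  | .pre _ _ => True
  | .post _ _ => True
  | _ => False

/-- A symbolic program for graphs with vertex set `V`. The memory may hold arbitrary data, in
particular arbitrarily many vertex sets. The graph is not part of the program, so that its edges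
are accessible only through the one-step operations. -/
structure Program (V : Type) where
  State : Type
  init : State
  instr : State → Instr V State

namespace Program

variable {V : Type} (P : Program V) (G : Digraph V)

/-- One step of the execution on the graph `G`, where `b` is the outcome of the coin that is
tossed if the current instruction is a coin toss. -/
def next (b : Bool) (q : P.State) : P.State :=
  match P.instr q with
  | .halt _ => q
  | .compute q' => q'
  | .flip k => k b
  | .pre S k => k (Symbolic.pre G S)
  | .post S k => k (Symbolic.post G S)

/-- The configuration after `t` steps on the graph `G`; `ω t` is the coin of step `t`. -/
def run (ω : ℕ → Bool) : ℕ → P.State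
  | 0 => P.init
  | t + 1 => P.next G (ω t) (run ω t)

/-- The execution halts with the answer `b`. -/
def Outputs (ω : ℕ → Bool) (b : Bool) : Prop := ∃ t, P.instr (P.run G ω t) = .halt b

open Classical in
/-- The number of one-step operations in the whole execution (`⊤` if there are infinitely
many). -/
noncomputable def oneSteps (ω : ℕ → Bool) : ℕ∞ :=
  ⨆ t : ℕ, (((Finset.range t).filter fun i => (P.instr (P.run G ω i)).IsOneStep).card : ℕ∞)

/-- The program never tosses a coin. -/
def IsDeterministic : Prop := ∀ q k, P.instr q ≠ .flip k

end Program

/-- The law of an infinite sequence of independent fair coins. -/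
noncomputable def coinLaw : Measure (ℕ → Bool) :=
  Measure.infinitePi fun _ => (PMF.uniformOfFintype Bool).toMeasure

/-! ### The reachability problem -/

/-- An instance of the reachability problem: a directed graph on the vertices `0, …, n - 1`, a
start vertex and a set of target vertices. -/
structure ReachInstance where
  n : ℕ
  G : Digraph (Fin n)
  s : Fin n
  T : Set (Fin n)

/-- A (possibly randomized) symbolic algorithm for inputs that consist of a vertex set, a start
vertex and a target set, which are given explicitly, and of the edges of a graph, which are
accessible only through one-step operations. -/
def Algorithm : Type 1 := ∀ n : ℕ, Fin n → Set (Fin n) → Program (Fin n)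

namespace Algorithm

variable (A : Algorithm)

/-- No program of the algorithm tosses a coin. -/
def IsDeterministic : Prop := ∀ n s T, (A n s T).IsDeterministic

/-- With the coins `ω`, the algorithm halts on `I` with the correct answer to the question
whether the reachability objective holds. -/
def Correct (I : ReachInstance) (ω : ℕ → Bool) : Prop :=
  ∃ b : Bool, (A I.n I.s I.T).Outputs I.G ω b ∧ (b = true ↔ ReachObjective I.G I.s I.T)

/-- The number of one-step operations that the algorithm performs on `I` with the coins `ω`. -/
noncomputable def cost (I : ReachInstance) (ω : ℕ → Bool) : ℝ≥0∞ :=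
  ((A I.n I.s I.T).oneSteps I.G ω : ℝ≥0∞)

end Algorithm

end Symbolic

/-! A path graph with all backward edges and self-loops hides a missing forward edge well. Let the
start be `0`, the target `D`, and compare the graph without a gap below `D` to its variants lacking
one edge `k → k + 1`, `k < D`; the answer is yes for the former and no for each variant. Post of a
set changes only if `k` is its maximum, Pre only if `k + 1` is its minimum, so one operation rules
out at most one `k` (`distinguishes_gapGraph_unique`). With fixed coins, a run correct on the intact
graph thus costs at least the number of variants on which the same coins are correct
(`card_correct_le_cost`). Determinism gives `D`; with error `ε`, each variant counts with
probability at least `1 - 2ε`, and linearity of expectation gives `(1 - 2ε)D`. -/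

namespace Symbolic

/-! ### Executions on two graphs -/

/-- The instruction is a one-step operation whose result on `G` differs from that on `H`. -/
def Instr.Distinguishes {V State : Type} (G H : Digraph V) : Instr V State → Prop
  | .pre S _ => Symbolic.pre G S ≠ Symbolic.pre H S
  | .post S _ => Symbolic.post G S ≠ Symbolic.post H S
  | _ => False

theorem Instr.Distinguishes.isOneStep {V State : Type} {G H : Digraph V} {i : Instr V State}
    (h : i.Distinguishes G H) : i.IsOneStep := by
  cases i <;> simp_all [Instr.Distinguishes, Instr.IsOneStep]

namespace Program

variable {V : Type} (P : Program V)

theorem next_eq_of_not_distinguishes {G H : Digraph V} {q : P.State}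
    (h : ¬ (P.instr q).Distinguishes G H) (b : Bool) : P.next H b q = P.next G b q := by
  unfold next
  cases hq : P.instr q <;> simp_all [Instr.Distinguishes]

theorem run_eq_of_not_distinguishes {G H : Digraph V} {ω : ℕ → Bool}
    (h : ∀ t, ¬ (P.instr (P.run G ω t)).Distinguishes G H) (t : ℕ) :
    P.run H ω t = P.run G ω t := by
  induction t with
  | zero => rfl
  | succ t ih =>
    simp only [run]
    rw [ih]
    exact P.next_eq_of_not_distinguishes (h t) _

theorem instr_run_of_halt {G : Digraph V} {ω : ℕ → Bool} {t u : ℕ} {b : Bool} (htu : t ≤ u)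
    (h : P.instr (P.run G ω t) = .halt b) : P.instr (P.run G ω u) = .halt b := by
  induction u, htu using Nat.le_induction with
  | base => exact h
  | succ u _ ih =>
    have : P.run G ω (u + 1) = P.run G ω u := by simp [run, next, ih]
    rw [this, ih]

theorem Outputs.unique {P : Program V} {G : Digraph V} {ω : ℕ → Bool} {b b' : Bool}
    (h : P.Outputs G ω b) (h' : P.Outputs G ω b') : b = b' := by
  obtain ⟨t, ht⟩ := h
  obtain ⟨u, hu⟩ := h'
  have h1 := P.instr_run_of_halt (le_max_left t u) ht
  have h2 := P.instr_run_of_halt (le_max_right t u) hu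
  rw [h1] at h2
  exact Instr.halt.inj h2

theorem exists_distinguishes {G H : Digraph V} {ω : ℕ → Bool} {b b' : Bool}
    (h : P.Outputs G ω b) (h' : P.Outputs H ω b') (hb : b ≠ b') :
    ∃ t, (P.instr (P.run G ω t)).Distinguishes G H := by
  by_contra! hc
  obtain ⟨t, ht⟩ := h'
  rw [P.run_eq_of_not_distinguishes hc] at ht
  exact hb (h.unique ⟨t, ht⟩)

/-- If no instruction distinguishes `G` from two of the graphs `H k`, `k ∈ K`, then distinguishing
`G` from all of them takes a one-step operation for each. -/
theorem card_le_oneSteps {ι : Type*} {G : Digraph V} {H : ι → Digraph V} {ω : ℕ → Bool}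
    (K : Finset ι)
    (huniq : ∀ (i : Instr V P.State), ∀ k ∈ K, ∀ l ∈ K,
      i.Distinguishes G (H k) → i.Distinguishes G (H l) → k = l)
    (hK : ∀ k ∈ K, ∃ t, (P.instr (P.run G ω t)).Distinguishes G (H k)) :
    (K.card : ℕ∞) ≤ P.oneSteps G ω := by
  classical
  choose! t ht using hK
  unfold oneSteps
  refine le_trans ?_ (le_iSup _ (K.sup t + 1))
  rw [Nat.cast_le]
  -- Distinct `k` are detected at distinct times, since one instruction detects at most one.
  refine Finset.card_le_card_of_injOn t ?_ ?_
  · intro k hk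
    simp only [Finset.coe_filter, Finset.mem_range, Set.mem_ofPred_eq]
    exact ⟨Nat.lt_succ_of_le (Finset.le_sup (f := t) hk), (ht k hk).isOneStep⟩
  · intro k hk l hl hkl
    have h := ht l hl
    rw [← hkl] at h
    exact huniq _ k hk l hl (ht k hk) h

/-- Arbitrary `s` is allowed because the configuration at time `t` depends on finitely many coins
only. -/
theorem measurableSet_run_mem (G : Digraph V) (t : ℕ) (s : Set P.State) :
    MeasurableSet {ω | P.run G ω t ∈ s} := by
  induction t generalizing s with
  | zero => simp [run]
  | succ t ih =>
    have : {ω | P.run G ω (t + 1) ∈ s} =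
        ⋃ b : Bool, (fun ω : ℕ → Bool => ω t) ⁻¹' {b} ∩ {ω | P.run G ω t ∈ P.next G b ⁻¹' s} := by
      ext ω
      simp [run]
    rw [this]
    exact .iUnion fun b => ((measurable_pi_apply t) (measurableSet_singleton b)).inter (ih _)

theorem measurableSet_outputs (G : Digraph V) (b : Bool) :
    MeasurableSet {ω | P.Outputs G ω b} := by
  simp only [Outputs, Set.ofPred_exists]
  exact .iUnion fun t => P.measurableSet_run_mem G t {q | P.instr q = .halt b}

end Program

theorem Algorithm.measurableSet_correct (A : Algorithm) (I : ReachInstance) :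
    MeasurableSet {ω | A.Correct I ω} := by
  simp only [Algorithm.Correct, Set.ofPred_exists, Set.ofPred_and]
  exact .iUnion fun b => (Program.measurableSet_outputs _ _ b).inter (.const _)

instance : IsProbabilityMeasure coinLaw := by
  unfold coinLaw
  infer_instance

/-! ### The hard instances -/

/-- The graph on `0, …, 2D + 1` with all edges `i → j`, `j ≤ i + 1`, except for `D → D + 1` and
`k → k + 1`. -/
def gapGraph (D k : ℕ) : Digraph (Fin (2 * D + 2)) where
  Adj i j := j.val ≤ i.val + 1 ∧ (j.val = i.val + 1 → i.val ≠ D ∧ i.val ≠ k)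

/-- The instance of deciding whether `0` can reach `D` in `gapGraph D k`. -/
def gapInstance (D k : ℕ) : ReachInstance where
  n := 2 * D + 2
  G := gapGraph D k
  s := ⟨0, by omega⟩
  T := {v | v.val = D}

/-- Only `k + 1` can be lost, and any `i > k` in `S` would retain it through a backward edge or
self-loop. -/
theorem post_gapGraph_ne {D k : ℕ} {S : Set (Fin (2 * D + 2))}
    (h : post (gapGraph D D) S ≠ post (gapGraph D k) S) :
    (∃ i ∈ S, i.val = k) ∧ ∀ i ∈ S, i.val ≤ k := by
  have hsub : post (gapGraph D k) S ⊆ post (gapGraph D D) S := by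
    rintro v ⟨s, hs, h1, h2⟩
    exact ⟨s, hs, h1, fun e => ⟨(h2 e).1, (h2 e).1⟩⟩
  obtain ⟨v, ⟨s, hs, h1, h2⟩, hv⟩ := Set.not_subset.1 fun h' => h (h'.antisymm hsub)
  have key : v.val = s.val + 1 ∧ s.val = k := by
    by_contra hc
    exact hv ⟨s, hs, h1, fun e => ⟨(h2 e).1, fun e' => hc ⟨e, e'⟩⟩⟩
  refine ⟨⟨s, hs, key.2⟩, fun i hi => ?_⟩
  by_contra hik
  exact hv ⟨i, hi, by omega, fun e => by omega⟩

theorem pre_gapGraph_ne {D k : ℕ} {S : Set (Fin (2 * D + 2))}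
    (h : pre (gapGraph D D) S ≠ pre (gapGraph D k) S) :
    (∃ i ∈ S, i.val = k + 1) ∧ ∀ i ∈ S, k + 1 ≤ i.val := by
  have hsub : pre (gapGraph D k) S ⊆ pre (gapGraph D D) S := by
    rintro v ⟨s, hs, h1, h2⟩
    exact ⟨s, hs, h1, fun e => ⟨(h2 e).1, (h2 e).1⟩⟩
  obtain ⟨v, ⟨s, hs, h1, h2⟩, hv⟩ := Set.not_subset.1 fun h' => h (h'.antisymm hsub)
  have key : s.val = v.val + 1 ∧ v.val = k := by
    by_contra hc
    exact hv ⟨s, hs, h1, fun e => ⟨(h2 e).1, fun e' => hc ⟨e, e'⟩⟩⟩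
  refine ⟨⟨s, hs, by omega⟩, fun i hi => ?_⟩
  by_contra hik
  exact hv ⟨i, hi, by omega, fun e => by omega⟩

theorem distinguishes_gapGraph_unique {D k l : ℕ} {State : Type}
    {i : Instr (Fin (2 * D + 2)) State}
    (hk : i.Distinguishes (gapGraph D D) (gapGraph D k))
    (hl : i.Distinguishes (gapGraph D D) (gapGraph D l)) : k = l := by
  cases i with
  | pre S _ =>
    obtain ⟨⟨a, ha, hak⟩, h1⟩ := pre_gapGraph_ne hk
    obtain ⟨⟨b, hb, hbl⟩, h2⟩ := pre_gapGraph_ne hl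
    have := h1 b hb
    have := h2 a ha
    omega
  | post S _ =>
    obtain ⟨⟨a, ha, hak⟩, h1⟩ := post_gapGraph_ne hk
    obtain ⟨⟨b, hb, hbl⟩, h2⟩ := post_gapGraph_ne hl
    have := h1 b hb
    have := h2 a ha
    omega
  | _ => exact hk.elim

theorem HasWalk.le_add {D k m : ℕ} {u v : Fin (2 * D + 2)} (h : HasWalk (gapGraph D k) m u v) :
    v.val ≤ u.val + m := by
  induction m generalizing u with
  | zero => exact (congrArg Fin.val h).ge
  | succ m ih =>
    obtain ⟨w, hw, hwv⟩ := h
    have := ih hwv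
    have := hw.1
    omega

theorem adj_gapGraph_le {D k g : ℕ} (hg : g = D ∨ g = k) {u v : Fin (2 * D + 2)}
    (h : (gapGraph D k).Adj u v) (hu : u.val ≤ g) : v.val ≤ g := by
  obtain ⟨h1, h2⟩ := h
  by_contra hv
  have := h2 (by omega)
  omega

theorem HasWalk.le_gap {D k m g : ℕ} (hg : g = D ∨ g = k) {u v : Fin (2 * D + 2)}
    (h : HasWalk (gapGraph D k) m u v) (hu : u.val ≤ g) : v.val ≤ g := by
  induction m generalizing u with
  | zero => exact (congrArg Fin.val h) ▸ hu
  | succ m ih =>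
    obtain ⟨w, hw, hwv⟩ := h
    exact ih hwv (adj_gapGraph_le hg hw hu)

theorem hasWalk_gapGraph {D k m : ℕ} {u v : Fin (2 * D + 2)} (hm : v.val = u.val + m)
    (hD : ¬ (u.val ≤ D ∧ D < v.val)) (hk : ¬ (u.val ≤ k ∧ k < v.val)) :
    HasWalk (gapGraph D k) m u v := by
  induction m generalizing u with
  | zero => exact Fin.ext hm.symm
  | succ m ih =>
    refine ⟨⟨u.val + 1, by omega⟩, ⟨le_rfl, fun _ => by omega⟩, ih ?_ ?_ ?_⟩ <;>
      simp only [] <;> omega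

theorem hasDiameter_gapGraph {D k : ℕ} (hD : 1 ≤ D) (hk : k ≤ D) :
    HasDiameter (gapGraph D k) D := by
  constructor
  -- The block from `D + 1` to `2D + 1` lies beyond both gaps and fixes the diameter independently
  -- of `k`.
  · have hw : HasWalk (gapGraph D k) D ⟨D + 1, by omega⟩ ⟨2 * D + 1, by omega⟩ := by
      apply hasWalk_gapGraph <;> simp only [] <;> omega
    refine ⟨_, _, ⟨D, hw⟩, le_antisymm (Nat.sInf_le hw) (le_csInf ⟨D, hw⟩ fun m hm => ?_)⟩
    have := HasWalk.le_add hm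
    simp only [] at this
    omega
  · rintro _ ⟨u, v, ⟨m, hm⟩, rfl⟩
    rcases le_or_gt v.val u.val with huv | huv
    -- Backward edges and self-loops give distance at most 1, hence the need for `1 ≤ D`.
    · refine le_trans (Nat.sInf_le ?_) hD
      exact ⟨v, ⟨by omega, fun e => by omega⟩, rfl⟩
    · have h1 := hm.le_gap (Or.inl rfl)
      have h2 := hm.le_gap (Or.inr rfl)
      refine le_trans (Nat.sInf_le (m := v.val - u.val) ?_) (by omega)
      exact hasWalk_gapGraph (by omega) (by omega) (by omega)

theorem reachObjective_gapInstance (D : ℕ) :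
    ReachObjective (gapInstance D D).G (gapInstance D D).s (gapInstance D D).T := by
  refine ⟨fun i => (⟨min i D, by omega⟩ : Fin (2 * D + 2)), Fin.ext (by simp [gapInstance]),
    fun i => ⟨?_, fun e => ?_⟩, D, min_self D⟩
  · simp only []
    omega
  · simp only [] at e ⊢
    omega

theorem not_reachObjective_gapInstance {D k : ℕ} (hk : k < D) :
    ¬ ReachObjective (gapInstance D k).G (gapInstance D k).s (gapInstance D k).T := by
  rintro ⟨p, h0, hp, i, hi⟩
  have h : ∀ i, (p i).val ≤ k := by
    intro i
    induction i with
    | zero => simp [h0, gapInstance]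
    | succ i ih => exact adj_gapGraph_le (Or.inr rfl) (hp i) ih
  have h1 := h i
  have h2 : (p i).val = D := hi
  omega

/-! ### Counting detected gaps and averaging over the coins -/

theorem Algorithm.exists_distinguishes_gapGraph (A : Algorithm) {D k : ℕ} (hk : k < D)
    {ω : ℕ → Bool} (h : A.Correct (gapInstance D D) ω) (h' : A.Correct (gapInstance D k) ω) :
    ∃ t, Instr.Distinguishes (gapGraph D D) (gapGraph D k)
      ((A _ (gapInstance D D).s (gapInstance D D).T).instr
        ((A _ (gapInstance D D).s (gapInstance D D).T).run (gapGraph D D) ω t)) := by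
  obtain ⟨b, hb, hb'⟩ := h
  obtain ⟨c, hc, hc'⟩ := h'
  refine Program.exists_distinguishes _ hb hc ?_
  rintro rfl
  exact not_reachObjective_gapInstance hk (hc'.1 (hb'.2 (reachObjective_gapInstance D)))

open Classical in
theorem Algorithm.card_correct_le_cost (A : Algorithm) (D : ℕ) {ω : ℕ → Bool}
    (h : A.Correct (gapInstance D D) ω) :
    (((Finset.range D).filter fun k => A.Correct (gapInstance D k) ω).card : ℝ≥0∞) ≤
      A.cost (gapInstance D D) ω := by
  have key := Program.card_le_oneSteps (A _ (gapInstance D D).s (gapInstance D D).T)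
    (G := gapGraph D D) (H := gapGraph D) (ω := ω)
    ((Finset.range D).filter fun k => A.Correct (gapInstance D k) ω)
    (fun i k _ l _ => distinguishes_gapGraph_unique)
    (fun k hk => by
      rw [Finset.mem_filter, Finset.mem_range] at hk
      exact A.exists_distinguishes_gapGraph hk.1 h hk.2)
  rw [← ENat.toENNReal_coe]
  exact ENat.toENNReal_le.2 key

theorem hasDiameter_bot_zero : HasDiameter (⊥ : Digraph (Fin 1)) 0 := by
  constructor
  · exact ⟨0, 0, ⟨0, rfl⟩, Nat.sInf_eq_zero.2 (Or.inl rfl)⟩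
  · rintro _ ⟨u, v, -, rfl⟩
    exact Nat.sInf_le (Subsingleton.elim u v : u = v)

theorem exists_hasDiameter_zero : ∃ I : ReachInstance, HasDiameter I.G 0 :=
  ⟨⟨1, ⊥, 0, ∅⟩, hasDiameter_bot_zero⟩

theorem coinLaw_inter_ge {ε : ℝ} {A B : Set (ℕ → Bool)} (hε : ε < 1 / 2)
    (hB : MeasurableSet B) (hA1 : ENNReal.ofReal (1 - ε) ≤ coinLaw A)
    (hB1 : ENNReal.ofReal (1 - ε) ≤ coinLaw B) :
    ENNReal.ofReal (1 - 2 * ε) ≤ coinLaw (A ∩ B) := by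
  have h := measure_union_add_inter (μ := coinLaw) A hB
  -- Inclusion-exclusion, with 1 added to both sides to avoid truncated subtraction.
  have h1 : ENNReal.ofReal (1 - 2 * ε) + 1 ≤ coinLaw (A ∩ B) + 1 := by
    calc ENNReal.ofReal (1 - 2 * ε) + 1
        = ENNReal.ofReal (1 - ε) + ENNReal.ofReal (1 - ε) := by
          rw [← ENNReal.ofReal_one, ← ENNReal.ofReal_add (by linarith) (by norm_num),
            ← ENNReal.ofReal_add (by linarith) (by linarith)]
          ring_nf
      _ ≤ coinLaw A + coinLaw B := add_le_add hA1 hB1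
      _ = coinLaw (A ∩ B) + coinLaw (A ∪ B) := by rw [← h, add_comm]
      _ ≤ coinLaw (A ∩ B) + 1 := by gcongr; exact prob_le_one
  exact (ENNReal.add_le_add_iff_right ENNReal.one_ne_top).1 h1

theorem Algorithm.le_lintegral_cost (A : Algorithm) {D : ℕ} {ε : ℝ} (hε : ε < 1 / 2)
    (hA : ∀ k ≤ D, ENNReal.ofReal (1 - ε) ≤ coinLaw {ω | A.Correct (gapInstance D k) ω}) :
    ENNReal.ofReal ((1 - 2 * ε) * D) ≤ ∫⁻ ω, A.cost (gapInstance D D) ω ∂coinLaw := by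
  classical
  let Q : ℕ → Set (ℕ → Bool) := fun k =>
    {ω | A.Correct (gapInstance D D) ω} ∩ {ω | A.Correct (gapInstance D k) ω}
  have hQ : ∀ k, MeasurableSet (Q k) := fun k =>
    (A.measurableSet_correct _).inter (A.measurableSet_correct _)
  calc ENNReal.ofReal ((1 - 2 * ε) * D)
      = ∑ _k ∈ Finset.range D, ENNReal.ofReal (1 - 2 * ε) := by
        rw [Finset.sum_const, Finset.card_range, nsmul_eq_mul, mul_comm,
          ENNReal.ofReal_mul (Nat.cast_nonneg D), ENNReal.ofReal_natCast]
    _ ≤ ∑ k ∈ Finset.range D, coinLaw (Q k) := Finset.sum_le_sum fun k hk =>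
        coinLaw_inter_ge hε (A.measurableSet_correct _) (hA D le_rfl)
          (hA k (Finset.mem_range.1 hk).le)
    _ = ∫⁻ ω, ∑ k ∈ Finset.range D, (Q k).indicator 1 ω ∂coinLaw := by
        rw [lintegral_finsetSum _ fun k _ => measurable_one.indicator (hQ k)]
        exact Finset.sum_congr rfl fun k _ => (lintegral_indicator_one (hQ k)).symm
    _ ≤ ∫⁻ ω, A.cost (gapInstance D D) ω ∂coinLaw := by
        refine lintegral_mono fun ω => ?_
        -- The count bounds the cost only for coins correct on the intact graph; for the others
        -- every indicator vanishes.
        by_cases h : A.Correct (gapInstance D D) ω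
        · refine le_of_eq_of_le ?_ (A.card_correct_le_cost D h)
          simp [Q, Set.indicator_apply, h, Finset.sum_boole]
        · simp [Q, h]

end Symbolic

theorem theorem3p3 :
    -- deterministic algorithms
    (∃ c : ℝ, 0 < c ∧ ∀ (D : ℕ) (A : Symbolic.Algorithm), A.IsDeterministic →
      (∀ I : Symbolic.ReachInstance, Symbolic.HasDiameter I.G D → ∀ ω, A.Correct I ω) →
      ∃ I : Symbolic.ReachInstance, Symbolic.HasDiameter I.G D ∧
        ∀ ω, ENNReal.ofReal (c * D) ≤ A.cost I ω) ∧
    -- randomized algorithms with error probability at most `ε`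
    (∀ ε : ℝ, 0 ≤ ε → ε < 1 / 2 → ∃ c : ℝ, 0 < c ∧ ∀ (D : ℕ) (A : Symbolic.Algorithm),
      (∀ I : Symbolic.ReachInstance, Symbolic.HasDiameter I.G D →
        ENNReal.ofReal (1 - ε) ≤ Symbolic.coinLaw {ω | A.Correct I ω}) →
      ∃ I : Symbolic.ReachInstance, Symbolic.HasDiameter I.G D ∧
        ENNReal.ofReal (c * D) ≤ ∫⁻ ω, A.cost I ω ∂Symbolic.coinLaw) := by
  constructor
  · refine ⟨1, one_pos, fun D A _ hA => ?_⟩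
    -- For `D = 0` the bound is trivial but needs another graph: `gapGraph 0 0` has the edge `1 →
    -- 0`, so its diameter is 1.
    rcases Nat.eq_zero_or_pos D with rfl | hD
    · obtain ⟨I, hI⟩ := Symbolic.exists_hasDiameter_zero
      exact ⟨I, hI, fun ω => by simp⟩
    · have hC : ∀ k ≤ D, ∀ ω, A.Correct (Symbolic.gapInstance D k) ω := fun k hk =>
        hA _ (Symbolic.hasDiameter_gapGraph hD hk)
      refine ⟨Symbolic.gapInstance D D, Symbolic.hasDiameter_gapGraph hD le_rfl, fun ω => ?_⟩
      classical
      have h := A.card_correct_le_cost D (hC D le_rfl ω)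
      rw [Finset.filter_true_of_mem fun k hk => hC k (Finset.mem_range.1 hk).le ω,
        Finset.card_range] at h
      simpa using h
  · intro ε _ hε
    refine ⟨1 - 2 * ε, by linarith, fun D A hA => ?_⟩
    rcases Nat.eq_zero_or_pos D with rfl | hD
    · obtain ⟨I, hI⟩ := Symbolic.exists_hasDiameter_zero
      exact ⟨I, hI, by simp⟩
    · exact ⟨Symbolic.gapInstance D D, Symbolic.hasDiameter_gapGraph hD le_rfl,
        A.le_lintegral_cost hε fun k hk =>
          hA _ (Symbolic.hasDiameter_gapGraph hD hk)⟩
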